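/- Let $(\Omega,\Sigma,\mu)$ be a $\sigma$-finite measure space. A Banach function space over $\mu$ is a linear subspace of $L^0(\mu)$ (real measurable functions modulo $\mu$-a.e. equality) with a complete norm such that $|f|\le|g|$ $\mu$-a.e. and $g$ in the space imply that $f$ is in the space and $\|f\|\le\|g\|$; a Banach sequence space is a Banach function space over $\mathbb N$ with the counting measure. For two such spaces $X,Y$ over the same measure, $X^Y=\{h: hf\in Y \text{ for all } f\in X\}$, and $B_{X^Y}$ is the set of $h\in X^Y$ with $\|hf\|_Y\le 1$ whenever $\|f\|_X\le1$. For a Banach sequence space $\ell$, $\ell'=\{y:\ \sum_j|x_jy_j|<\infty \text{ for all }x\in\ell\}$ with $\|y\|_{\ell'}=\sup_{\|x\|_\ell\le1}\sum_j|x_jy_j|$. For Banach sequence spaces $\Lambda,\ell$, the product $\Lambda\pi\ell'$ is the space of all sequences $w$ such that $|w|\le\sum_n|f_nk_n|$ coordinatewise for some $f_n\in\Lambda$, $k_n\in\ell'$ with $\sum_n\|f_n\|_\Lambda\|k_n\|_{\ell'}<\infty$, and $\pi(w)$ is the infimum of these sums. **Theorem.** Let $X(\mu)$ and $L(\mu)$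 be Banach function spaces and let $\Lambda,\ell$ be Banach sequence spaces. Let $\mathcal B$ be a Schauder basis of $L(\mu)$ with coefficient functionals $(\alpha_j)_{j\in\mathbb N}$ such that $\mathcal F(f):=(\alpha_j(f))_j\in\Lambda$ for all $f\in L(\mu)$. Suppose that $\Lambda\pi\ell'$ is saturated (for each $j$ it contains some $w$ with $w_j\ne0$) and that $(\Lambda\pi\ell')^*=\Lambda^\ell$, i.e. $\sum_jg_jw_j$ converges for all $g\in\Lambda^\ell$ and $w\in\Lambda\pi\ell'$, and the linear functionals on $\Lambda\pi\ell'$ that are bounded with respect to $\pi$ are exactly the functionals $w\mapsto\sum_jg_jw_j$ with $g\in\Lambda^\ell$. Let $h$ be a measurable function with $0<|h|$ $\mu$-a.e. and $h\in X(\mu)^{L(\mu)}$. For a continuous linear operator $T:X(\mu)\to\ell$ the following are equivalent. (i) There is a constant $C>0$ such that for every finite set $J\subseteq\mathbb N$, every $n\in\mathbb N$, all $x_1,\dots,x_n\in X(\mu)$ and all $y_1',\dots,y_n'\in\ell'$, $$\sum_{i=1}^n\sum_{j\in J}T(x_i)_j\,(y_i')_j\le C\sup_{g\in B_{\Lambda^\ell}}\sum_{i=1}^n\sum_{j\in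 J}\alpha_j(hx_i)\,g_j\,(y_i')_j .$$ (ii) There is a sequence $g\in\Lambda^\ell$ such that $T(x)_j=g_j\,\alpha_j(hx)$ for all $x\in X(\mu)$ and $j\in\mathbb N$. (iii) There is $g\in\Lambda^\ell$ with $T=M_g\circ\mathcal F\circ M_h$, where $M_h:X(\mu)\to L(\mu)$ and $M_g:\Lambda\to\ell$ are the multiplication operators $M_h x=hx$ and $M_g a=ga$. -/

import Mathlib

open MeasureTheory Filter Topology
open scoped ENNReal

noncomputable section

/-- A Banach ideal of a real vector lattice `E`: a linear subspace with a complete norm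
which is solid, i.e. `|f| ≤ |g|` and `g` in the space imply that `f` is in the space with
`‖f‖ ≤ ‖g‖`. For `E = L⁰(μ)` these are the Banach function spaces over `μ`, for `E = ℝ^ℕ` (which is
`L⁰` of the counting measure) the Banach sequence spaces. -/
structure BanachIdeal (E : Type*) [AddCommGroup E] [Lattice E] [Module ℝ E] where
  space : Submodule ℝ E
  norm : space → ℝ
  norm_nonneg : ∀ f, 0 ≤ norm f
  eq_zero_of_norm : ∀ f, norm f = 0 → f = 0
  norm_smul : ∀ (c : ℝ) (f : space), norm (c • f) = |c| * norm f
  norm_add_le : ∀ f g : space, norm (f + g) ≤ norm f + norm g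
  solid : ∀ (f : E) (g : space), |f| ≤ |(g : E)| → ∃ hf : f ∈ space, norm ⟨f, hf⟩ ≤ norm g
  complete : ∀ u : ℕ → space,
    (∀ ε > 0, ∃ N, ∀ m ≥ N, ∀ n ≥ N, norm (u m - u n) < ε) →
      ∃ f : space, ∀ ε > 0, ∃ N, ∀ n ≥ N, norm (u n - f) < ε

namespace BanachIdeal

variable {E : Type*} [AddCommGroup E] [Lattice E] [Module ℝ E]

/-- The underlying type of a Banach ideal; it carries the norm topology (and not the topology
induced by `E`). -/
def Carrier (X : BanachIdeal E) : Type _ := X.space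

instance : CoeSort (BanachIdeal E) (Type _) := ⟨Carrier⟩

instance (X : BanachIdeal E) : AddCommGroup X := inferInstanceAs (AddCommGroup X.space)

instance (X : BanachIdeal E) : Module ℝ X := inferInstanceAs (Module ℝ X.space)

instance (X : BanachIdeal E) : Norm X := ⟨X.norm⟩

theorem core (X : BanachIdeal E) : NormedSpace.Core ℝ X where
  norm_nonneg := X.norm_nonneg
  norm_smul := X.norm_smul
  norm_triangle := X.norm_add_le
  norm_eq_zero_iff f := ⟨X.eq_zero_of_norm f, by
    rintro rfl
    have h := X.norm_smul 0 0
    rw [zero_smul, abs_zero, zero_mul] at h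
    exact h⟩

instance (X : BanachIdeal E) : NormedAddCommGroup X := NormedAddCommGroup.ofCore X.core

instance (X : BanachIdeal E) : NormedSpace ℝ X := NormedSpace.ofCore X.core

instance (X : BanachIdeal E) : CompleteSpace X := by
  refine Metric.complete_of_cauchySeq_tendsto fun u hu => ?_
  obtain ⟨f, hf⟩ := X.complete u fun ε hε => by
    obtain ⟨N, hN⟩ := Metric.cauchySeq_iff.1 hu ε hε
    exact ⟨N, fun m hm n hn => by
      have h := hN m hm n hn
      rw [dist_eq_norm] at h
      exact h⟩
  refine ⟨f, Metric.tendsto_atTop.2 fun ε hε => ?_⟩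
  obtain ⟨N, hN⟩ := hf ε hε
  exact ⟨N, fun n hn => by
    change dist (u n) (show X from f) < ε
    rw [dist_eq_norm]
    exact hN n hn⟩

/-- The inclusion of a Banach ideal in the ambient space, as a linear map. -/
def incl (X : BanachIdeal E) : X →ₗ[ℝ] E := X.space.subtype

variable [Mul E] [LeftDistribClass E] [SMulCommClass ℝ E E]

/-- The space `X^Y` of multipliers from `X` to `Y`: all `h` with `h f ∈ Y` for all `f ∈ X`. -/
def multipliers (X Y : BanachIdeal E) : Set E := {h | ∀ f ∈ X.space, h * f ∈ Y.space}

/-- The multiplication operator `M_h : X → Y`, `f ↦ h f`, of a multiplier `h ∈ X^Y`. -/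
def mulOp {X Y : BanachIdeal E} {h : E} (hh : h ∈ multipliers X Y) : X →ₗ[ℝ] Y where
  toFun f := (⟨h * X.incl f, hh _ f.2⟩ : Y.space)
  map_add' f g := Subtype.ext (by
    change h * X.incl (f + g) = h * X.incl f + h * X.incl g
    rw [map_add, mul_add])
  map_smul' c f := Subtype.ext (by
    change h * X.incl (c • f) = c • (h * X.incl f)
    rw [map_smul, mul_smul_comm])

/-- The closed unit ball of `X^Y` for the operator norm
`‖h‖ = sup {‖h f‖_Y : ‖f‖_X ≤ 1}`. -/
def multiplierBall (X Y : BanachIdeal E) : Set E :=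
  {h | ∃ hh : h ∈ multipliers X Y, ∀ f : X, ‖f‖ ≤ 1 → ‖mulOp hh f‖ ≤ 1}

end BanachIdeal

instance {Ω : Type*} [MeasurableSpace Ω] (μ : Measure Ω) : LeftDistribClass (Ω →ₘ[μ] ℝ) where
  left_distrib f g h := by
    ext1
    filter_upwards [AEEqFun.coeFn_mul f (g + h), AEEqFun.coeFn_add g h,
      AEEqFun.coeFn_add (f * g) (f * h), AEEqFun.coeFn_mul f g, AEEqFun.coeFn_mul f h]
      with ω h1 h2 h3 h4 h5
    simp [h1, h2, h3, h4, h5, mul_add]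

instance {Ω : Type*} [MeasurableSpace Ω] (μ : Measure Ω) :
    SMulCommClass ℝ (Ω →ₘ[μ] ℝ) (Ω →ₘ[μ] ℝ) where
  smul_comm c f g := by
    ext1
    filter_upwards [AEEqFun.coeFn_smul c (f * g), AEEqFun.coeFn_mul f g,
      AEEqFun.coeFn_mul f (c • g), AEEqFun.coeFn_smul c g] with ω h1 h2 h3 h4
    simp [h1, h2, h3, h4, mul_left_comm]

/-- Banach function spaces over a measure `μ`: Banach ideals of the space `L⁰(μ)` of classes of
measurable real functions modulo `μ`-a.e. equality. -/
abbrev BanachFunctionSpace {Ω : Type*} [MeasurableSpace Ω] (μ : Measure Ω) : Type _ :=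
  BanachIdeal (Ω →ₘ[μ] ℝ)

/-- Banach sequence spaces: Banach function spaces over `ℕ` with the counting measure, for which
`L⁰ = ℝ^ℕ`. -/
abbrev BanachSequenceSpace : Type := BanachIdeal (ℕ → ℝ)

namespace BanachSequenceSpace

open BanachIdeal

/-- The Köthe dual `ℓ'`: all `y` such that `x y` is (absolutely) summable for all `x ∈ ℓ`. -/
def koetheDual (ℓ : BanachSequenceSpace) : Set (ℕ → ℝ) :=
  {y | ∀ x : ℓ, Summable fun j => ℓ.incl x j * y j}

/-- The norm `sup {∑ⱼ |xⱼ yⱼ| : ‖x‖ ≤ 1}` of the Köthe dual. -/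
def koetheNorm (ℓ : BanachSequenceSpace) (y : ℕ → ℝ) : ℝ≥0∞ :=
  ⨆ (x : ℓ) (_ : ‖x‖ ≤ 1), ∑' j, ‖ℓ.incl x j * y j‖ₑ

/-- The norm `π` of the product `Λ π ℓ'` of `Λ` with the Köthe dual of `ℓ`: the infimum of
`∑ₙ ‖fₙ‖ ‖kₙ‖` over all sequences `fₙ` in `Λ` and `kₙ` in `ℓ'` with `|w| ≤ ∑ₙ |fₙ kₙ|`. It is
infinite if there are no such sequences with a finite sum of norms. -/
def piNorm (Λ ℓ : BanachSequenceSpace) (w : ℕ → ℝ) : ℝ≥0∞ :=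
  ⨅ (f : ℕ → Λ) (k : ℕ → koetheDual ℓ)
    (_ : ∀ j, ‖w j‖ₑ ≤ ∑' n, ‖Λ.incl (f n) j * (k n : ℕ → ℝ) j‖ₑ),
    ∑' n, ‖f n‖ₑ * koetheNorm ℓ (k n)

theorem piNorm_lt_top_iff (Λ ℓ : BanachSequenceSpace) (w : ℕ → ℝ) :
    piNorm Λ ℓ w < ∞ ↔ ∃ (f : ℕ → Λ) (k : ℕ → koetheDual ℓ),
      (∀ j, ‖w j‖ₑ ≤ ∑' n, ‖Λ.incl (f n) j * (k n : ℕ → ℝ) j‖ₑ) ∧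
        ∑' n, ‖f n‖ₑ * koetheNorm ℓ (k n) < ∞ := by
  simp only [piNorm, iInf_lt_iff, exists_prop]

/-- The product space `Λ π ℓ'`: all sequences `w` with `π(w) < ∞`, that is, all `w` such that
`|w| ≤ ∑ₙ |fₙ kₙ|` for some `fₙ` in `Λ` and `kₙ` in `ℓ'` with `∑ₙ ‖fₙ‖ ‖kₙ‖ < ∞`. -/
def piSpace (Λ ℓ : BanachSequenceSpace) : Submodule ℝ (ℕ → ℝ) where
  carrier := {w | piNorm Λ ℓ w < ∞}
  zero_mem' := by
    refine (piNorm_lt_top_iff Λ ℓ 0).2 ⟨fun _ => 0, fun _ => ⟨0, fun x => ?_⟩, ?_, ?_⟩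
    · simp
    · simp
    · simp
  add_mem' := by
    intro u v hu hv
    obtain ⟨f, k, hfk, hs⟩ := (piNorm_lt_top_iff Λ ℓ u).1 hu
    obtain ⟨f', k', hfk', hs'⟩ := (piNorm_lt_top_iff Λ ℓ v).1 hv
    let e : ℕ ≃ ℕ ⊕ ℕ := Equiv.natSumNatEquivNat.symm
    refine (piNorm_lt_top_iff Λ ℓ (u + v)).2
      ⟨fun n => Sum.elim f f' (e n), fun n => Sum.elim k k' (e n), fun j => ?_, ?_⟩
    · rw [e.tsum_eq fun s : ℕ ⊕ ℕ =>
        ‖Λ.incl (Sum.elim f f' s) j * (Sum.elim k k' s : koetheDual ℓ).1 j‖ₑ,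
        ENNReal.summable.tsum_sum ENNReal.summable]
      exact (enorm_add_le _ _).trans (add_le_add (hfk j) (hfk' j))
    · rw [e.tsum_eq fun s : ℕ ⊕ ℕ =>
        ‖Sum.elim f f' s‖ₑ * koetheNorm ℓ (Sum.elim k k' s : koetheDual ℓ).1,
        ENNReal.summable.tsum_sum ENNReal.summable]
      exact ENNReal.add_lt_top.2 ⟨hs, hs'⟩
  smul_mem' := by
    intro c u hu
    obtain ⟨f, k, hfk, hs⟩ := (piNorm_lt_top_iff Λ ℓ u).1 hu
    refine (piNorm_lt_top_iff Λ ℓ (c • u)).2 ⟨fun n => c • f n, k, fun j => ?_, ?_⟩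
    · simp only [map_smul, Pi.smul_apply, smul_eq_mul, mul_assoc, enorm_mul, ENNReal.tsum_mul_left]
      gcongr
      simpa only [enorm_mul] using hfk j
    · simp only [enorm_smul, mul_assoc, ENNReal.tsum_mul_left]
      exact ENNReal.mul_lt_top (by simp) hs

/-- A space of sequences is saturated if no coordinate vanishes on the whole space. (For the
counting measure, a set of positive measure is a nonempty set.) -/
def IsSaturated (V : Submodule ℝ (ℕ → ℝ)) : Prop := ∀ j, ∃ w ∈ V, w j ≠ 0

/-- A linear functional on `Λ π ℓ'` is continuous if it is bounded with respect to `π`. -/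
def IsContinuousFunctional {Λ ℓ : BanachSequenceSpace} (φ : piSpace Λ ℓ →ₗ[ℝ] ℝ) : Prop :=
  ∃ M : ℝ, ∀ w : piSpace Λ ℓ, |φ w| ≤ M * (piNorm Λ ℓ w).toReal

/-- The identity `(Λ π ℓ')* = Λ^ℓ` for the canonical pairing `⟨g, w⟩ = ∑ⱼ gⱼ wⱼ`: the pairing is
defined on `Λ^ℓ × Λ π ℓ'`, and the continuous linear functionals on `Λ π ℓ'` are exactly the
functionals `⟨g, ·⟩` with `g ∈ Λ^ℓ`. -/
def DualEqMultipliers (Λ ℓ : BanachSequenceSpace) : Prop :=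
  (∀ g ∈ multipliers Λ ℓ, ∀ w ∈ piSpace Λ ℓ, Summable fun j => g j * w j) ∧
    ∀ φ : piSpace Λ ℓ →ₗ[ℝ] ℝ, IsContinuousFunctional φ ↔
      ∃ g ∈ multipliers Λ ℓ, ∀ w : piSpace Λ ℓ, φ w = ∑' j, g j * (w : ℕ → ℝ) j

end BanachSequenceSpace

/-- The basis operator `f ↦ (αⱼ(f))ⱼ` of a Schauder basis of `L` whose sequences of basic
coefficients lie in the sequence space `Λ`. -/
def basisOperator {Ω : Type*} [MeasurableSpace Ω] {μ : Measure Ω} {L : BanachFunctionSpace μ}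
    (b : SchauderBasis ℝ L.Carrier) {Λ : BanachSequenceSpace}
    (hb : ∀ f : L, (fun j => b.coord j f) ∈ Λ.space) : L →ₗ[ℝ] Λ where
  toFun f := (⟨fun j => b.coord j f, hb f⟩ : Λ.space)
  map_add' f g := Subtype.ext (by
    funext j
    exact map_add (b.coord j) f g)
  map_smul' c f := Subtype.ext (by
    funext j
    exact map_smul (b.coord j) c f)

end

/-! For (i) ⇒ (ii), take the unit vectors as the `y_i'`. The double sums in (i) collapse to
diagonals: for every finitely supported family `d` in `X`, `∑ⱼ T(dⱼ)ⱼ ≤ C sup_g ∑ⱼ gⱼ wⱼ` with `wⱼ =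
αⱼ(h dⱼ)`, and the right side is at most `C π(w)` (`sum_mul_le_piNorm`). By Hahn–Banach
(`exists_factor_of_le_sublinear`), `d ↦ ∑ⱼ T(dⱼ)ⱼ` factors through `d ↦ w` by a functional bounded
for `π`. The duality hypothesis represents it by some `g ∈ Λ^ℓ`, and families concentrated at one
index give `T(x)ⱼ = gⱼ αⱼ(hx)` (`exists_multiplier_of_le_piNorm`). For (ii) ⇒ (i), `M_g` is bounded
by the closed graph theorem, so a positive multiple of `g` competes in the supremum. (ii) ⇔ (iii) is
coordinatewise equality. -/

/-- A linear functional given on the range of a linear map `A` and dominated there by a sublinear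
function extends to a dominated linear functional on the whole space. -/
theorem exists_factor_of_le_sublinear {D E : Type*} [AddCommGroup D] [Module ℝ D]
    [AddCommGroup E] [Module ℝ E] (A : D →ₗ[ℝ] E) (B : D →ₗ[ℝ] ℝ) (N : E → ℝ)
    (N_hom : ∀ c : ℝ, 0 < c → ∀ x, N (c • x) = c * N x) (N_add : ∀ x y, N (x + y) ≤ N x + N y)
    (hB : ∀ d, B d ≤ N (A d)) :
    ∃ φ : E →ₗ[ℝ] ℝ, (∀ d, φ (A d) = B d) ∧ ∀ x, φ x ≤ N x := by
  have N_zero : N 0 = 0 := by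
    have h2 := N_hom 2 two_pos 0
    rw [smul_zero] at h2
    linarith
  -- Domination at both `d` and `-d` forces `B d = 0`, so `B` descends to the range of `A`.
  have hker : ∀ d, A d = 0 → B d = 0 := by
    intro d hd
    have h1 := hB d
    have h2 := hB (-d)
    rw [map_neg, map_neg, hd, neg_zero, N_zero] at h2
    rw [hd, N_zero] at h1
    linarith
  obtain ⟨s, hs⟩ := A.rangeRestrict.exists_rightInverse_of_surjective A.range_rangeRestrict
  have hAs : ∀ x, A (s x) = x := fun x => congrArg Subtype.val (LinearMap.congr_fun hs x)
  obtain ⟨φ, hφ, hφN⟩ := exists_extension_of_le_sublinear ⟨A.range, B ∘ₗ s⟩ N N_hom N_add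
    fun x => (hB (s x)).trans_eq (congrArg N (hAs x))
  refine ⟨φ, fun d => (hφ ⟨A d, A.mem_range_self d⟩).trans ?_, hφN⟩
  have h0 := hker (s ⟨A d, A.mem_range_self d⟩ - d) (by rw [map_sub, hAs, sub_self])
  rw [map_sub] at h0
  exact sub_eq_zero.1 h0

/-! ### Continuity of coordinates and of multiplication operators -/

namespace BanachIdeal

/-- If some element has a nonzero `j`-th coordinate, solidity puts the unit vector `e_j` in `Y` and
gives `|x_j| ‖e_j‖ ≤ ‖x‖`, hence `c = ‖e_j‖⁻¹`. -/
theorem exists_abs_coord_le (Y : BanachSequenceSpace) (j : ℕ) :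
    ∃ c : ℝ, ∀ x : Y, |Y.incl x j| ≤ c * ‖x‖ := by
  by_cases hj : ∃ x : Y, Y.incl x j ≠ 0
  · obtain ⟨x₀, hx₀⟩ := hj
    have hle : ∀ x : Y, |(Pi.single j (Y.incl x j) : ℕ → ℝ)| ≤ |Y.incl x| := by
      intro x i
      rcases eq_or_ne i j with rfl | hij
      · simp
      · simp [hij]
    have hmem : (Pi.single j 1 : ℕ → ℝ) ∈ Y.space := by
      obtain ⟨hs, -⟩ := Y.solid _ x₀ (hle x₀)
      convert Y.space.smul_mem (Y.incl x₀ j)⁻¹ hs using 1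
      rw [← Pi.single_smul, smul_eq_mul, inv_mul_cancel₀ hx₀]
    let v : Y := (⟨Pi.single j 1, hmem⟩ : Y.space)
    have hv : v ≠ 0 := fun h0 => by
      have h1 : Y.incl v j = 0 := by rw [h0, map_zero]; rfl
      have h2 : Y.incl v j = 1 := Pi.single_eq_same (M := fun _ => ℝ) j 1
      exact one_ne_zero (h2.symm.trans h1)
    refine ⟨‖v‖⁻¹, fun x => ?_⟩
    obtain ⟨hs, hn⟩ := Y.solid _ x (hle x)
    have he : (Y.incl x j) • v = (⟨_, hs⟩ : Y.space) := Subtype.ext (by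
      change (Y.incl x j) • (Pi.single j 1 : ℕ → ℝ) = _
      rw [← Pi.single_smul, smul_eq_mul, mul_one])
    have hn' : ‖(Y.incl x j) • v‖ ≤ ‖x‖ := by rw [he]; exact hn
    rw [_root_.norm_smul, Real.norm_eq_abs] at hn'
    rw [inv_mul_eq_div, le_div_iff₀ (norm_pos_iff.2 hv)]
    exact hn'
  · push Not at hj
    exact ⟨0, fun x => by simp [hj x]⟩

theorem continuous_coord (Y : BanachSequenceSpace) (j : ℕ) :
    Continuous fun x : Y => Y.incl x j := by
  obtain ⟨c, hc⟩ := exists_abs_coord_le Y j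
  exact AddMonoidHomClass.continuous_of_bound ((LinearMap.proj j : (ℕ → ℝ) →ₗ[ℝ] ℝ) ∘ₗ Y.incl) c hc

theorem incl_mulOp {X Y : BanachSequenceSpace} {g : ℕ → ℝ} (hg : g ∈ multipliers X Y) (f : X)
    (j : ℕ) : Y.incl (mulOp hg f) j = g j * X.incl f j := rfl

/-- The graph is closed because norm limits in both spaces are determined coordinatewise. -/
theorem continuous_mulOp {X Y : BanachSequenceSpace} {g : ℕ → ℝ} (hg : g ∈ multipliers X Y) :
    Continuous (mulOp hg) := by
  refine (mulOp hg).continuous_of_seq_closed_graph fun u x y hu hy => Subtype.ext ?_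
  funext j
  exact tendsto_nhds_unique (((continuous_coord Y j).tendsto y).comp hy)
    ((((continuous_coord X j).tendsto x).comp hu).const_mul (g j))

theorem exists_inv_smul_mem_multiplierBall {X Y : BanachSequenceSpace} {g : ℕ → ℝ}
    (hg : g ∈ multipliers X Y) : ∃ C : ℝ, 0 < C ∧ C⁻¹ • g ∈ multiplierBall X Y := by
  obtain ⟨C, hC, hle⟩ := (⟨mulOp hg, continuous_mulOp hg⟩ : X →L[ℝ] Y).bound
  have hmem : C⁻¹ • g ∈ multipliers X Y := fun f hf => by
    rw [smul_mul_assoc]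
    exact Y.space.smul_mem _ (hg f hf)
  refine ⟨C, hC, hmem, fun f hf => ?_⟩
  have he : mulOp hmem f = C⁻¹ • mulOp hg f := Subtype.ext (smul_mul_assoc C⁻¹ g (X.incl f))
  rw [he, _root_.norm_smul, norm_inv, Real.norm_of_nonneg hC.le, inv_mul_le_iff₀ hC]
  exact (hle f).trans (mul_le_mul_of_nonneg_left hf hC.le)

theorem norm_mulOp_le {X Y : BanachSequenceSpace} {g : ℕ → ℝ} (hg : g ∈ multipliers X Y)
    (hball : ∀ f : X, ‖f‖ ≤ 1 → ‖mulOp hg f‖ ≤ 1) (f : X) : ‖mulOp hg f‖ ≤ ‖f‖ := by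
  rcases eq_or_ne f 0 with rfl | hf
  · simp
  have hf' : 0 < ‖f‖ := norm_pos_iff.2 hf
  have h1 := hball (‖f‖⁻¹ • f) (by rw [_root_.norm_smul, norm_inv, norm_norm, inv_mul_cancel₀ hf'.ne'])
  rwa [map_smul, _root_.norm_smul, norm_inv, norm_norm, inv_mul_le_iff₀ hf', mul_one] at h1

end BanachIdeal

/-! ### The norm `π` and its duality with multipliers -/

namespace BanachSequenceSpace

open BanachIdeal

theorem tsum_enorm_mul_le (ℓ : BanachSequenceSpace) (x : ℓ) (y : ℕ → ℝ) :
    ∑' j, ‖ℓ.incl x j * y j‖ₑ ≤ ‖x‖ₑ * koetheNorm ℓ y := by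
  rcases eq_or_ne x 0 with rfl | hx
  · simp
  have hx' : 0 < ‖x‖ := norm_pos_iff.2 hx
  have h1 : ∑' j, ‖ℓ.incl (‖x‖⁻¹ • x) j * y j‖ₑ ≤ koetheNorm ℓ y :=
    le_iSup₂ (f := fun (x : ℓ) (_ : ‖x‖ ≤ 1) => ∑' j, ‖ℓ.incl x j * y j‖ₑ) (‖x‖⁻¹ • x)
      (by rw [_root_.norm_smul, norm_inv, norm_norm, inv_mul_cancel₀ hx'.ne'])
  calc ∑' j, ‖ℓ.incl x j * y j‖ₑ = ∑' j, ‖x‖ₑ * ‖ℓ.incl (‖x‖⁻¹ • x) j * y j‖ₑ := by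
        refine tsum_congr fun j => ?_
        rw [map_smul, Pi.smul_apply, smul_eq_mul, ← enorm_norm x, ← enorm_mul, mul_assoc,
          mul_inv_cancel_left₀ hx'.ne']
    _ = ‖x‖ₑ * ∑' j, ‖ℓ.incl (‖x‖⁻¹ • x) j * y j‖ₑ := ENNReal.tsum_mul_left
    _ ≤ _ := by gcongr

/-- If `|w| ≤ ∑ₙ |fₙ kₙ|`, exchanging sums in `ℝ≥0∞` bounds the left side by `∑ₙ ‖g fₙ‖ ‖kₙ‖`, and
`‖g fₙ‖ ≤ ‖fₙ‖`. -/
theorem tsum_enorm_mul_le_piNorm {Λ ℓ : BanachSequenceSpace} {g : ℕ → ℝ}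
    (hg : g ∈ multiplierBall Λ ℓ) (w : ℕ → ℝ) : ∑' j, ‖g j * w j‖ₑ ≤ piNorm Λ ℓ w := by
  obtain ⟨hm, hball⟩ := hg
  refine le_iInf fun f => le_iInf fun k => le_iInf fun hfk => ?_
  calc ∑' j, ‖g j * w j‖ₑ
      ≤ ∑' j, ∑' n, ‖ℓ.incl (mulOp hm (f n)) j * (k n : ℕ → ℝ) j‖ₑ := by
        refine ENNReal.tsum_le_tsum fun j => ?_
        simp only [incl_mulOp, mul_assoc, enorm_mul (g j), ENNReal.tsum_mul_left]
        gcongr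
        exact hfk j
    _ = ∑' n, ∑' j, ‖ℓ.incl (mulOp hm (f n)) j * (k n : ℕ → ℝ) j‖ₑ := ENNReal.tsum_comm
    _ ≤ ∑' n, ‖f n‖ₑ * koetheNorm ℓ (k n) := by
        refine ENNReal.tsum_le_tsum fun n => (tsum_enorm_mul_le ℓ _ _).trans ?_
        gcongr
        rw [← ofReal_norm, ← ofReal_norm]
        exact ENNReal.ofReal_le_ofReal (norm_mulOp_le hm hball _)

theorem sum_mul_le_piNorm {Λ ℓ : BanachSequenceSpace} {g : ℕ → ℝ}
    (hg : g ∈ multiplierBall Λ ℓ) (w : piSpace Λ ℓ) (J : Finset ℕ) :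
    ∑ j ∈ J, g j * (w : ℕ → ℝ) j ≤ (piNorm Λ ℓ w).toReal := by
  refine (le_abs_self _).trans ?_
  have h1 : ‖∑ j ∈ J, g j * (w : ℕ → ℝ) j‖ₑ ≤ piNorm Λ ℓ w :=
    (enorm_sum_le _ _).trans ((ENNReal.sum_le_tsum J).trans (tsum_enorm_mul_le_piNorm hg w))
  have h2 := ENNReal.toReal_mono (ne_of_lt w.2) h1
  rwa [toReal_enorm] at h2

theorem piNorm_mono (Λ ℓ : BanachSequenceSpace) {u v : ℕ → ℝ} (huv : ∀ j, |u j| ≤ |v j|) :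
    piNorm Λ ℓ u ≤ piNorm Λ ℓ v := by
  refine le_iInf fun f => le_iInf fun k => le_iInf fun hfk => ?_
  exact iInf_le_of_le f (iInf_le_of_le k (iInf_le_of_le
    (fun j => le_trans (by
      rw [← ofReal_norm, ← ofReal_norm]
      exact ENNReal.ofReal_le_ofReal (huv j)) (hfk j)) le_rfl))

theorem piNorm_neg (Λ ℓ : BanachSequenceSpace) (w : ℕ → ℝ) :
    piNorm Λ ℓ (-w) = piNorm Λ ℓ w :=
  le_antisymm (piNorm_mono Λ ℓ fun j => by simp) (piNorm_mono Λ ℓ fun j => by simp)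

theorem piNorm_add_le (Λ ℓ : BanachSequenceSpace) (u v : ℕ → ℝ) :
    piNorm Λ ℓ (u + v) ≤ piNorm Λ ℓ u + piNorm Λ ℓ v := by
  rw [piNorm.eq_1 Λ ℓ u, piNorm.eq_1 Λ ℓ v]
  simp only [ENNReal.iInf_add, ENNReal.add_iInf]
  refine le_iInf fun f' => le_iInf fun k' => le_iInf fun hfk' =>
    le_iInf fun f => le_iInf fun k => le_iInf fun hfk => ?_
  let e : ℕ ≃ ℕ ⊕ ℕ := Equiv.natSumNatEquivNat.symm
  refine iInf_le_of_le (fun n => Sum.elim f f' (e n)) (iInf_le_of_le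
    (fun n => Sum.elim k k' (e n)) (iInf_le_of_le (fun j => ?_) ?_))
  · rw [e.tsum_eq fun s : ℕ ⊕ ℕ =>
      ‖Λ.incl (Sum.elim f f' s) j * (Sum.elim k k' s : koetheDual ℓ).1 j‖ₑ,
      ENNReal.summable.tsum_sum ENNReal.summable]
    exact (enorm_add_le _ _).trans (add_le_add (hfk j) (hfk' j))
  · rw [e.tsum_eq fun s : ℕ ⊕ ℕ =>
      ‖Sum.elim f f' s‖ₑ * koetheNorm ℓ (Sum.elim k k' s : koetheDual ℓ).1,
      ENNReal.summable.tsum_sum ENNReal.summable]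
    exact le_rfl

theorem piNorm_smul_le (Λ ℓ : BanachSequenceSpace) {c : ℝ} (hc : c ≠ 0) (w : ℕ → ℝ) :
    piNorm Λ ℓ (c • w) ≤ ‖c‖ₑ * piNorm Λ ℓ w := by
  have hc' : ‖c‖ₑ ≠ 0 := enorm_ne_zero.2 hc
  rw [piNorm.eq_1 Λ ℓ w]
  simp only [ENNReal.mul_iInf_of_ne hc' enorm_ne_top]
  refine le_iInf fun f => le_iInf fun k => le_iInf fun hfk => ?_
  refine iInf_le_of_le (fun n => c • f n) (iInf_le_of_le k (iInf_le_of_le (fun j => ?_) ?_))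
  · simp only [map_smul, Pi.smul_apply, smul_eq_mul, mul_assoc, enorm_mul c,
      ENNReal.tsum_mul_left]
    gcongr
    exact hfk j
  · simp only [enorm_smul, mul_assoc, ENNReal.tsum_mul_left]
    exact le_rfl

theorem piNorm_smul (Λ ℓ : BanachSequenceSpace) {c : ℝ} (hc : c ≠ 0) (w : ℕ → ℝ) :
    piNorm Λ ℓ (c • w) = ‖c‖ₑ * piNorm Λ ℓ w := by
  refine (piNorm_smul_le Λ ℓ hc w).antisymm ?_
  calc ‖c‖ₑ * piNorm Λ ℓ w = ‖c‖ₑ * piNorm Λ ℓ (c⁻¹ • c • w) := by rw [inv_smul_smul₀ hc]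
    _ ≤ ‖c‖ₑ * (‖c⁻¹‖ₑ * piNorm Λ ℓ (c • w)) := by
        gcongr
        exact piNorm_smul_le Λ ℓ (inv_ne_zero hc) _
    _ = piNorm Λ ℓ (c • w) := by
        rw [← mul_assoc, ← enorm_mul, mul_inv_cancel₀ hc, enorm_one, one_mul]

/-- Saturation gives `w` with `w j ≠ 0`; the unit vector lies below `|w / w j|`, and `π` is
monotone. -/
theorem single_mem_piSpace {Λ ℓ : BanachSequenceSpace} (hsat : IsSaturated (piSpace Λ ℓ))
    (j : ℕ) : (Pi.single j 1 : ℕ → ℝ) ∈ piSpace Λ ℓ := by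
  obtain ⟨w, hw, hj⟩ := hsat j
  refine (piNorm_mono Λ ℓ (v := (w j)⁻¹ • w) fun i => ?_).trans_lt
    ((piSpace Λ ℓ).smul_mem (w j)⁻¹ hw)
  rcases eq_or_ne i j with rfl | hij
  · simp [inv_mul_cancel₀ hj]
  · rw [Pi.single_eq_of_ne hij, abs_zero]
    exact abs_nonneg _

theorem single_mem_koetheDual (ℓ : BanachSequenceSpace) (j : ℕ) :
    (Pi.single j 1 : ℕ → ℝ) ∈ koetheDual ℓ := fun x =>
  summable_of_ne_finset_zero (s := {j}) fun i hi => by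
    rw [Pi.single_eq_of_ne (by simpa using hi), mul_zero]

/-- A family of linear functionals `a j`, `t j` on `E` such that `∑ⱼ t j (d j)` is dominated by the
norm `π` of the finite sequences `(a j (d j))ⱼ` satisfies `t j = g j • a j` for a multiplier `g`. -/
theorem exists_multiplier_of_le_piNorm {Λ ℓ : BanachSequenceSpace}
    (hsat : IsSaturated (piSpace Λ ℓ)) (hdual : DualEqMultipliers Λ ℓ) {E : Type*}
    [AddCommGroup E] [Module ℝ E] (a t : ℕ → E →ₗ[ℝ] ℝ) {C : ℝ}
    (hC : 0 ≤ C) (hle : ∀ (d : ℕ →₀ E) (w : piSpace Λ ℓ), (∀ j, (w : ℕ → ℝ) j = a j (d j)) →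
      ∑ j ∈ d.support, t j (d j) ≤ C * (piNorm Λ ℓ w).toReal) :
    ∃ g ∈ multipliers Λ ℓ, ∀ x j, t j x = g j * a j x := by
  let e : ℕ → piSpace Λ ℓ := fun j => ⟨Pi.single j 1, single_mem_piSpace hsat j⟩
  let A : (ℕ →₀ E) →ₗ[ℝ] piSpace Λ ℓ := Finsupp.lsum ℝ fun j => (a j).smulRight (e j)
  let B : (ℕ →₀ E) →ₗ[ℝ] ℝ := Finsupp.lsum ℝ t
  have hA : ∀ d j, (A d : ℕ → ℝ) j = a j (d j) := by
    intro d j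
    have h1 : A d = ∑ i ∈ d.support, a i (d i) • e i := rfl
    rw [h1, Submodule.coe_sum, Finset.sum_apply, Finset.sum_eq_single j]
    · simp [e]
    · intro i _ hij
      simp [e, hij.symm]
    · intro hj
      rw [Finsupp.notMem_support_iff.1 hj]
      simp
  obtain ⟨φ, hφA, hφ⟩ := exists_factor_of_le_sublinear A B
    (fun w => C * (piNorm Λ ℓ w).toReal)
    (fun c hc w => by
      rw [Submodule.coe_smul, piNorm_smul Λ ℓ hc.ne', ENNReal.toReal_mul, toReal_enorm,
        Real.norm_of_nonneg hc.le, mul_left_comm])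
    (fun u v => by
      rw [← mul_add, ← ENNReal.toReal_add (ne_of_lt u.2) (ne_of_lt v.2)]
      exact mul_le_mul_of_nonneg_left (ENNReal.toReal_mono
        (ENNReal.add_ne_top.2 ⟨ne_of_lt u.2, ne_of_lt v.2⟩) (piNorm_add_le Λ ℓ u v)) hC)
    (fun d => hle d (A d) (hA d))
  -- Since `π(-w) = π(w)`, the one-sided bound on `φ` is two-sided.
  obtain ⟨g, hg, hφg⟩ := (hdual.2 φ).1 ⟨C, fun w => abs_le'.2 ⟨hφ w, by
    have h1 := hφ (-w)
    rwa [map_neg, Submodule.coe_neg, piNorm_neg] at h1⟩⟩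
  refine ⟨g, hg, fun x j => ?_⟩
  have hB : B (Finsupp.single j x) = t j x := by simp [B]
  rw [← hB, ← hφA, hφg, tsum_eq_single j, hA, Finsupp.single_eq_same]
  intro i hij
  rw [hA, Finsupp.single_eq_of_ne hij, map_zero, mul_zero]

end BanachSequenceSpace

-- A real `⨆` over an unbounded family is `0`, so this is needed for the supremum in (i) to dominate
-- its members. The bound uses `|(g fᵢ)ⱼ| ≤ |cⱼ| ‖fᵢ‖`, with `cⱼ` bounding the `j`-th coordinate on
-- `ℓ`.
open BanachIdeal BanachSequenceSpace in
theorem bddAbove_range_sum_multiplierBall {Λ ℓ : BanachSequenceSpace} (J : Finset ℕ) {n : ℕ}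
    (f : Fin n → Λ) (y : Fin n → ℕ → ℝ) :
    BddAbove (Set.range fun g : multiplierBall Λ ℓ =>
      ∑ i, ∑ j ∈ J, Λ.incl (f i) j * (g : ℕ → ℝ) j * y i j) := by
  choose c hc using exists_abs_coord_le ℓ
  refine ⟨∑ i, ∑ j ∈ J, |c j| * ‖f i‖ * |y i j|, ?_⟩
  rintro _ ⟨⟨g, hm, hball⟩, rfl⟩
  refine Finset.sum_le_sum fun i _ => Finset.sum_le_sum fun j _ => ?_
  refine (le_abs_self _).trans ?_
  rw [abs_mul, mul_comm (Λ.incl (f i) j), ← incl_mulOp hm]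
  gcongr
  refine (hc j _).trans ?_
  gcongr
  · exact le_abs_self _
  · exact norm_mulOp_le hm hball _

theorem theorem6p3 {Ω : Type*} [MeasurableSpace Ω] (μ : Measure Ω) [SigmaFinite μ]
    (X L : BanachFunctionSpace μ) (Λ ℓ : BanachSequenceSpace)
    (b : SchauderBasis ℝ L) (hb : ∀ f : L, (fun j => b.coord j f) ∈ Λ.space)
    (hsat : BanachSequenceSpace.IsSaturated (BanachSequenceSpace.piSpace Λ ℓ))
    (hdual : BanachSequenceSpace.DualEqMultipliers Λ ℓ)
    (h : Ω →ₘ[μ] ℝ) (hh : h ∈ BanachIdeal.multipliers X L) (hpos : ∀ᵐ ω ∂μ, 0 < |h ω|)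
    (T : X →L[ℝ] ℓ) :
    List.TFAE [
      ∃ C : ℝ, 0 < C ∧ ∀ (J : Finset ℕ) (n : ℕ) (x : Fin n → X)
        (y : Fin n → BanachSequenceSpace.koetheDual ℓ),
        ∑ i, ∑ j ∈ J, ℓ.incl (T (x i)) j * (y i : ℕ → ℝ) j ≤
          C * ⨆ g : BanachIdeal.multiplierBall Λ ℓ,
            ∑ i, ∑ j ∈ J,
              b.coord j (BanachIdeal.mulOp hh (x i)) * (g : ℕ → ℝ) j * (y i : ℕ → ℝ) j,
      ∃ g ∈ BanachIdeal.multipliers Λ ℓ, ∀ (x : X) (j : ℕ),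
        ℓ.incl (T x) j = g j * b.coord j (BanachIdeal.mulOp hh x),
      ∃ (g : ℕ → ℝ) (hg : g ∈ BanachIdeal.multipliers Λ ℓ),
        (T : X →ₗ[ℝ] ℓ) = BanachIdeal.mulOp hg ∘ₗ basisOperator b hb ∘ₗ BanachIdeal.mulOp hh] := by

  tfae_have 2 ↔ 3 := by
    constructor
    · rintro ⟨g, hg, hT⟩
      exact ⟨g, hg, LinearMap.ext fun x => Subtype.ext (funext fun j => hT x j)⟩
    · rintro ⟨g, hg, hT⟩
      exact ⟨g, hg, fun x j => congrArg (fun z : ℓ => ℓ.incl z j) (LinearMap.congr_fun hT x)⟩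
  tfae_have 2 → 1 := by
    rintro ⟨g, hg, hT⟩
    obtain ⟨C, hC, hball⟩ := BanachIdeal.exists_inv_smul_mem_multiplierBall hg
    refine ⟨C, hC, fun J n x y => ?_⟩
    have hsup := le_ciSup (bddAbove_range_sum_multiplierBall (ℓ := ℓ) J
      (fun i => basisOperator b hb (BanachIdeal.mulOp hh (x i))) fun i => (y i : ℕ → ℝ))
      ⟨_, hball⟩
    refine Eq.trans_le ?_ (mul_le_mul_of_nonneg_left hsup hC.le)
    simp only [Finset.mul_sum]
    refine Finset.sum_congr rfl fun i _ => Finset.sum_congr rfl fun j _ => ?_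
    change _ = C * (b.coord j (BanachIdeal.mulOp hh (x i)) * (C⁻¹ * g j) * (y i : ℕ → ℝ) j)
    rw [hT]
    field_simp
  tfae_have 1 → 2 := by
    rintro ⟨C, hC, hle⟩
    refine BanachSequenceSpace.exists_multiplier_of_le_piNorm hsat hdual
      (fun j => (b.coord j : L →ₗ[ℝ] ℝ) ∘ₗ BanachIdeal.mulOp hh)
      (fun j => (LinearMap.proj j : (ℕ → ℝ) →ₗ[ℝ] ℝ) ∘ₗ ℓ.incl ∘ₗ (T : X →ₗ[ℝ] ℓ))
      hC.le fun d w hw => ?_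
    have hsum : ∀ F : ℕ → ℝ,
        ∑ i, F (d.support.equivFin.symm i) = ∑ j ∈ d.support, F j := fun F =>
      (d.support.equivFin.symm.sum_comp fun j => F j).trans (Finset.sum_coe_sort d.support F)
    have hsingle : ∀ (F : ℕ → ℝ) (i : Fin d.support.card),
        ∑ j ∈ d.support, F j * (Pi.single (d.support.equivFin.symm i : ℕ) 1 : ℕ → ℝ) j =
          F (d.support.equivFin.symm i) := fun F i => by
      rw [Finset.sum_eq_single (d.support.equivFin.symm i : ℕ), Pi.single_eq_same, mul_one]
      · intro j _ hj
        rw [Pi.single_eq_of_ne hj, mul_zero]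
      · exact fun hi => absurd (d.support.equivFin.symm i).2 hi
    -- The support of `d` is enumerated by `Fin`; pairing `d j` with the unit vector at `j` leaves
    -- only the diagonal terms.
    have h1 := hle d.support d.support.card (fun i => d (d.support.equivFin.symm i)) fun i =>
      ⟨_, BanachSequenceSpace.single_mem_koetheDual ℓ (d.support.equivFin.symm i)⟩
    simp only [hsingle] at h1
    rw [hsum fun j => ℓ.incl (T (d j)) j] at h1
    refine h1.trans (mul_le_mul_of_nonneg_left (Real.iSup_le (fun g => ?_)
      ENNReal.toReal_nonneg) hC.le)
    rw [hsum fun j => b.coord j (BanachIdeal.mulOp hh (d j)) * (g : ℕ → ℝ) j]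
    refine Eq.trans_le ?_ (BanachSequenceSpace.sum_mul_le_piNorm g.2 w d.support)
    refine Finset.sum_congr rfl fun j _ => ?_
    rw [hw, mul_comm]
    rfl
  tfae_finish
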